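/- Let $\mathcal H$ and $\mathcal L$ be (complex) Hilbert spaces, let $\otimes$ denote the Hilbert space tensor product, $\mathcal U(\cdot)$ the group of unitary operators, and $\Sigma$ the flip of tensor factors; use leg numbering notation. A unitary $W\in\mathcal U(\mathcal H\otimes\mathcal H)$ is \emph{multiplicative} if $W_{23}W_{12}=W_{12}W_{13}W_{23}$. Let $(\mathbb W,U,V,\mathbb F)$ with $\mathbb W\in\mathcal U(\mathcal H\otimes\mathcal H)$, $U\in\mathcal U(\mathcal L\otimes\mathcal H)$, $V\in\mathcal U(\mathcal H\otimes\mathcal L)$, $\mathbb F\in\mathcal U(\mathcal L\otimes\mathcal L)$ be a (top-)braided multiplicative unitary, that is: 1. $\mathbb W$ is multiplicative; 2. $U$ is a right representation of $\mathbb W$: $\mathbb W_{23}U_{12}=U_{12}U_{13}\mathbb W_{23}$ on $\mathcal L\otimes\mathcal H\otimes\mathcal H$; 3. $V$ is a left representation of $\mathbb W$: $V_{23}\mathbb W_{12}=\mathbb W_{12}V_{13}V_{23}$ on $\mathcal H\otimes\mathcal H\otimes\mathcal L$; 4. $U$ and $V$ are compatible: $U_{23}\mathbb W_{13}V_{12}=V_{12}\mathbb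 W_{13}U_{23}$ on $\mathcal H\otimes\mathcal L\otimes\mathcal H$; 5. $\mathbb F$ is $U$-invariant: $U_{13}U_{23}\mathbb F_{12}=\mathbb F_{12}U_{13}U_{23}$ on $\mathcal L\otimes\mathcal L\otimes\mathcal H$; 6. $\mathbb F$ is $V$-invariant: $V_{13}V_{12}\mathbb F_{23}=\mathbb F_{23}V_{13}V_{12}$ on $\mathcal H\otimes\mathcal L\otimes\mathcal L$; 7. there is $Z\in\mathcal U(\mathcal L\otimes\mathcal L)$ with $Z_{13}=V_{23}U_{12}^*V_{23}^*U_{12}$ on $\mathcal L\otimes\mathcal H\otimes\mathcal L$ such that, for the braiding $c:=Z\Sigma$, the braided pentagon equation $\mathbb F_{23}\mathbb F_{12}=\mathbb F_{12}c_{23}\mathbb F_{12}c_{23}^*\mathbb F_{23}$ holds on $\mathcal L\otimes\mathcal L\otimes\mathcal L$. For multiplicative unitaries $W^1\in\mathcal U(\mathcal H_1\otimes\mathcal H_1)$ and $W^2\in\mathcal U(\mathcal H_2\otimes\mathcal H_2)$, a \emph{bicharacter} from $W^1$ to $W^2$ is $X\in\mathcal U(\mathcal H_1\otimes\mathcal H_2)$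 with $W^2_{23}X_{12}=X_{12}X_{13}W^2_{23}$ and $X_{23}W^1_{12}=W^1_{12}X_{13}X_{23}$. The \emph{composite} of $X\in\mathcal U(\mathcal H_1\otimes\mathcal H_2)$ and $Y\in\mathcal U(\mathcal H_2\otimes\mathcal H_3)$ is, if it exists, the unique $T\in\mathcal U(\mathcal H_1\otimes\mathcal H_3)$ with $Y_{23}X_{12}=X_{12}T_{13}Y_{23}$. Define $$\mathbb W^C:=\mathbb W_{13}U_{23}V_{34}^*\mathbb F_{24}V_{34}\in\mathcal U(\mathcal H\otimes\mathcal L\otimes\mathcal H\otimes\mathcal L),\qquad \mathbb P:=\mathbb W_{13}U_{23}\in\mathcal U(\mathcal H\otimes\mathcal L\otimes\mathcal H\otimes\mathcal L).$$ Then $\mathbb W^C$ is a multiplicative unitary on the Hilbert space $\mathcal H\otimes\mathcal L$; the operator $\mathbb W_{13}U_{23}\in\mathcal U((\mathcal H\otimes\mathcal L)\otimes\mathcal H)$ is a bicharacter from $\mathbb W^C$ to $\mathbb W$; the operator $\mathbb W_{12}\in\mathcal U(\mathcal H\otimes(\mathcal H\otimes\mathcal L))$ is a bicharacter from $\mathbb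 W$ to $\mathbb W^C$; and their composite from $\mathbb W^C$ to itself exists and is $\mathbb P$. Moreover, $\mathbb P$ is an idempotent bicharacter from $\mathbb W^C$ to itself, that is, the following equations hold on the threefold tensor product of $\mathcal H\otimes\mathcal L$: $$\mathbb P_{23}\mathbb W^C_{12}=\mathbb W^C_{12}\mathbb P_{13}\mathbb P_{23},\qquad \mathbb W^C_{23}\mathbb P_{12}=\mathbb P_{12}\mathbb P_{13}\mathbb W^C_{23},\qquad \mathbb P_{23}\mathbb P_{12}=\mathbb P_{12}\mathbb P_{13}\mathbb P_{23}.$$ -/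

import Mathlib

open scoped TensorProduct

noncomputable section

/-- The Hilbert space tensor product: the completion of the algebraic tensor product for the
inner product `⟪a ⊗ b, c ⊗ d⟫ = ⟪a, c⟫ * ⟪b, d⟫`. -/
def HilbertTensor (A B : Type*) [NormedAddCommGroup A] [InnerProductSpace ℂ A]
    [NormedAddCommGroup B] [InnerProductSpace ℂ B] : Type _ :=
  UniformSpace.Completion (A ⊗[ℂ] B)

infixr:70 "⊗ᴴ" => HilbertTensor

/-- The unitary operators on `E`, as a group under composition; the inverse is the adjoint. -/
abbrev UnitaryOp (E : Type*) [NormedAddCommGroup E] [InnerProductSpace ℂ E] : Type _ :=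
  E ≃ₗᵢ[ℂ] E

namespace HilbertTensor

variable {A B C D : Type*} [NormedAddCommGroup A] [InnerProductSpace ℂ A]
  [NormedAddCommGroup B] [InnerProductSpace ℂ B] [NormedAddCommGroup C] [InnerProductSpace ℂ C]
  [NormedAddCommGroup D] [InnerProductSpace ℂ D]

instance instNormedAddCommGroup : NormedAddCommGroup (A ⊗ᴴ B) :=
  inferInstanceAs (NormedAddCommGroup (UniformSpace.Completion (A ⊗[ℂ] B)))

instance instInnerProductSpace : InnerProductSpace ℂ (A ⊗ᴴ B) :=
  inferInstanceAs (InnerProductSpace ℂ (UniformSpace.Completion (A ⊗[ℂ] B)))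

instance instCompleteSpace : CompleteSpace (A ⊗ᴴ B) :=
  inferInstanceAs (CompleteSpace (UniformSpace.Completion (A ⊗[ℂ] B)))

variable (A B) in
/-- The canonical isometric embedding of the algebraic tensor product. -/
def incl : A ⊗[ℂ] B →ₗᵢ[ℂ] A ⊗ᴴ B :=
  (UniformSpace.Completion.toComplₗᵢ :
    A ⊗[ℂ] B →ₗᵢ[ℂ] UniformSpace.Completion (A ⊗[ℂ] B))

/-- The elementary tensor `a ⊗ b`. -/
def tmul (a : A) (b : B) : A ⊗ᴴ B := incl A B (a ⊗ₜ[ℂ] b)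

theorem denseRange_incl : DenseRange (incl A B) :=
  UniformSpace.Completion.denseRange_coe

/-- Tensoring two linear isometries with dense range gives an isometry with dense range. -/
theorem denseRange_mapIsometry {f : A →ₗᵢ[ℂ] C} {g : B →ₗᵢ[ℂ] D}
    (hf : DenseRange f) (hg : DenseRange g) :
    DenseRange (TensorProduct.mapIsometry f g) := by
  intro z
  have key : (⊤ : Submodule ℂ (C ⊗[ℂ] D)) ≤
      (LinearMap.range (TensorProduct.mapIsometry f g).toLinearMap).topologicalClosure := by
    rw [← TensorProduct.span_tmul_eq_top, Submodule.span_le]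
    rintro _ ⟨c, d, rfl⟩
    have hcont : Continuous fun p : C × D => p.1 ⊗ₜ[ℂ] p.2 := TensorProduct.continuous_tmul
    have hd : (c, d) ∈ closure (Set.range (Prod.map f g)) := (hf.prodMap hg) (c, d)
    have h2 := image_closure_subset_closure_image hcont ⟨(c, d), hd, rfl⟩
    refine closure_mono ?_ h2
    rintro _ ⟨_, ⟨⟨a, b⟩, rfl⟩, rfl⟩
    exact ⟨a ⊗ₜ b, by simp⟩
  exact key (Submodule.mem_top (x := z))

/-- The isometric isomorphism `f ⊗ g`. -/
def map (f : A ≃ₗᵢ[ℂ] C) (g : B ≃ₗᵢ[ℂ] D) : A ⊗ᴴ B ≃ₗᵢ[ℂ] C ⊗ᴴ D :=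
  (TensorProduct.congrIsometry f g).toLinearEquiv.extendOfIsometry
    (incl A B).toLinearMap (incl C D).toLinearMap denseRange_incl denseRange_incl
    fun x => by
      change ‖incl C D (TensorProduct.congrIsometry f g x)‖ = ‖incl A B x‖
      simp only [LinearIsometry.norm_map, LinearIsometryEquiv.norm_map]

variable (A B) in
/-- The flip `Σ`, given by `a ⊗ b ↦ b ⊗ a`. -/
def comm : A ⊗ᴴ B ≃ₗᵢ[ℂ] B ⊗ᴴ A :=
  (TensorProduct.commIsometry ℂ A B).toLinearEquiv.extendOfIsometry
    (incl A B).toLinearMap (incl B A).toLinearMap denseRange_incl denseRange_incl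
    fun x => by
      change ‖incl B A (TensorProduct.commIsometry ℂ A B x)‖ = ‖incl A B x‖
      simp only [LinearIsometry.norm_map, LinearIsometryEquiv.norm_map]

variable (A B C) in
/-- The canonical embedding of `(A ⊗ B) ⊗ C` from the algebraic triple tensor product. -/
def inclL : (A ⊗[ℂ] B) ⊗[ℂ] C →ₗᵢ[ℂ] (A ⊗ᴴ B) ⊗ᴴ C :=
  (incl (A ⊗ᴴ B) C).comp (TensorProduct.mapIsometry (incl A B) LinearIsometry.id)

variable (A B C) in
/-- The canonical embedding of `A ⊗ (B ⊗ C)` from the algebraic triple tensor product. -/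
def inclR : A ⊗[ℂ] (B ⊗[ℂ] C) →ₗᵢ[ℂ] A ⊗ᴴ (B ⊗ᴴ C) :=
  (incl A (B ⊗ᴴ C)).comp (TensorProduct.mapIsometry LinearIsometry.id (incl B C))

theorem denseRange_inclL : DenseRange (inclL A B C) :=
  denseRange_incl.comp (denseRange_mapIsometry denseRange_incl denseRange_id)
    (incl (A ⊗ᴴ B) C).continuous

theorem denseRange_inclR : DenseRange (inclR A B C) :=
  denseRange_incl.comp (denseRange_mapIsometry denseRange_id denseRange_incl)
    (incl A (B ⊗ᴴ C)).continuous

variable (A B C) in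
/-- The associator, given by `(a ⊗ b) ⊗ c ↦ a ⊗ (b ⊗ c)`. -/
def assoc : (A ⊗ᴴ B) ⊗ᴴ C ≃ₗᵢ[ℂ] A ⊗ᴴ (B ⊗ᴴ C) :=
  (TensorProduct.assocIsometry ℂ A B C).toLinearEquiv.extendOfIsometry
    (inclL A B C).toLinearMap (inclR A B C).toLinearMap denseRange_inclL denseRange_inclR
    fun x => by
      change ‖inclR A B C (TensorProduct.assocIsometry ℂ A B C x)‖ = ‖inclL A B C x‖
      simp only [LinearIsometry.norm_map, LinearIsometryEquiv.norm_map]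

theorem map_tmul (f : A ≃ₗᵢ[ℂ] C) (g : B ≃ₗᵢ[ℂ] D) (a : A) (b : B) :
    map f g (tmul a b) = tmul (f a) (g b) :=
  LinearEquiv.extendOfIsometry_eq _ (incl A B).toLinearMap (incl C D).toLinearMap _ _ _
    (a ⊗ₜ[ℂ] b)

theorem comm_tmul (a : A) (b : B) : comm A B (tmul a b) = tmul b a :=
  LinearEquiv.extendOfIsometry_eq _ (incl A B).toLinearMap (incl B A).toLinearMap _ _ _
    (a ⊗ₜ[ℂ] b)

theorem assoc_tmul (a : A) (b : B) (c : C) :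
    assoc A B C (tmul (tmul a b) c) = tmul a (tmul b c) :=
  LinearEquiv.extendOfIsometry_eq _ (inclL A B C).toLinearMap (inclR A B C).toLinearMap _ _ _
    ((a ⊗ₜ[ℂ] b) ⊗ₜ[ℂ] c)

/-- Transport of a unitary operator along an isometric isomorphism: `e T e⁻¹`. -/
def conj (e : A ≃ₗᵢ[ℂ] B) (T : UnitaryOp A) : UnitaryOp B := (e.symm.trans T).trans e

/-- Leg numbering on `A ⊗ (B ⊗ C)`: the operator `T₁₂`. -/
def leg12 (T : UnitaryOp (A ⊗ᴴ B)) : UnitaryOp (A ⊗ᴴ (B ⊗ᴴ C)) :=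
  conj (assoc A B C) (map T (1 : UnitaryOp C))

/-- Leg numbering on `A ⊗ (B ⊗ C)`: the operator `T₂₃ = 1 ⊗ T`. -/
def leg23 (T : UnitaryOp (B ⊗ᴴ C)) : UnitaryOp (A ⊗ᴴ (B ⊗ᴴ C)) :=
  map (1 : UnitaryOp A) T

/-- Leg numbering on `A ⊗ (B ⊗ C)`: the operator `T₁₃ = Σ₂₃ T₁₂ Σ₂₃`. -/
def leg13 (T : UnitaryOp (A ⊗ᴴ C)) : UnitaryOp (A ⊗ᴴ (B ⊗ᴴ C)) :=
  conj (map (1 : UnitaryOp A) (comm C B)) (leg12 T)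

end HilbertTensor

open HilbertTensor

section Definitions

variable {H L K A B C : Type*} [NormedAddCommGroup H] [InnerProductSpace ℂ H]
  [NormedAddCommGroup L] [InnerProductSpace ℂ L] [NormedAddCommGroup K] [InnerProductSpace ℂ K]
  [NormedAddCommGroup A] [InnerProductSpace ℂ A] [NormedAddCommGroup B] [InnerProductSpace ℂ B]
  [NormedAddCommGroup C] [InnerProductSpace ℂ C]

/-- The pentagon equation `W₂₃ W₁₂ = W₁₂ W₁₃ W₂₃` on `H ⊗ H ⊗ H`. -/
def IsMultiplicativeUnitary (W : UnitaryOp (H ⊗ᴴ H)) : Prop :=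
  (leg23 W * leg12 W : UnitaryOp (H ⊗ᴴ (H ⊗ᴴ H))) = leg12 W * leg13 W * leg23 W

/-- `S` is a right representation of `W` on `K`: `W₂₃ S₁₂ = S₁₂ S₁₃ W₂₃` on `K ⊗ H ⊗ H`. -/
def IsRightRep (W : UnitaryOp (H ⊗ᴴ H)) (S : UnitaryOp (K ⊗ᴴ H)) : Prop :=
  (leg23 W * leg12 S : UnitaryOp (K ⊗ᴴ (H ⊗ᴴ H))) = leg12 S * leg13 S * leg23 W

/-- `V` is a left representation of `W` on `K`: `V₂₃ W₁₂ = W₁₂ V₁₃ V₂₃` on `H ⊗ H ⊗ K`. -/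
def IsLeftRep (W : UnitaryOp (H ⊗ᴴ H)) (V : UnitaryOp (H ⊗ᴴ K)) : Prop :=
  (leg23 V * leg12 W : UnitaryOp (H ⊗ᴴ (H ⊗ᴴ K))) = leg12 W * leg13 V * leg23 V

/-- `X` is a bicharacter from `W₁` to `W₂`: it is a right representation of `W₂` on `A` and a
left representation of `W₁` on `B`. -/
def IsBicharacter (W₁ : UnitaryOp (A ⊗ᴴ A)) (W₂ : UnitaryOp (B ⊗ᴴ B))
    (X : UnitaryOp (A ⊗ᴴ B)) : Prop :=
  IsRightRep W₂ X ∧ IsLeftRep W₁ X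

/-- `Z` is the composite of the bicharacters `X` (from `A` to `B`) and `Y` (from `B` to `C`):
the unique unitary with `Y₂₃ X₁₂ = X₁₂ Z₁₃ Y₂₃` on `A ⊗ B ⊗ C`. -/
def IsCompositeBicharacter (X : UnitaryOp (A ⊗ᴴ B)) (Y : UnitaryOp (B ⊗ᴴ C))
    (Z : UnitaryOp (A ⊗ᴴ C)) : Prop :=
  ∀ Z' : UnitaryOp (A ⊗ᴴ C),
    (leg23 Y * leg12 X : UnitaryOp (A ⊗ᴴ (B ⊗ᴴ C))) = leg12 X * leg13 Z' * leg23 Y ↔ Z' = Z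

/-- `Z` is the unitary on `K ⊗ L` from which the braiding `L ⊗ K → K ⊗ L` is built as `Z Σ`:
`Z₁₃ = V₂₃ S₁₂* V₂₃* S₁₂` on `K ⊗ H ⊗ L`. -/
def IsBraidingUnitary (S : UnitaryOp (K ⊗ᴴ H)) (V : UnitaryOp (H ⊗ᴴ L))
    (Z : UnitaryOp (K ⊗ᴴ L)) : Prop :=
  (leg13 Z : UnitaryOp (K ⊗ᴴ (H ⊗ᴴ L))) =
    leg23 V * (leg12 S)⁻¹ * (leg23 V)⁻¹ * leg12 S

/-- `(W, U, V, F)` is a (top-)braided multiplicative unitary: `F` is a braided multiplicative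
unitary on `L` over the multiplicative unitary `W` on `H`, with respect to the right
representation `U` and the left representation `V` of `W` on `L`. -/
structure IsBraidedMultiplicativeUnitary (W : UnitaryOp (H ⊗ᴴ H)) (U : UnitaryOp (L ⊗ᴴ H))
    (V : UnitaryOp (H ⊗ᴴ L)) (F : UnitaryOp (L ⊗ᴴ L)) : Prop where
  multiplicative : IsMultiplicativeUnitary W
  rightRep : IsRightRep W U
  leftRep : IsLeftRep W V
  /-- Drinfeld (Yetter-Drinfeld) compatibility `U₂₃ W₁₃ V₁₂ = V₁₂ W₁₃ U₂₃` on `H ⊗ L ⊗ H`. -/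
  compatible : (leg23 U * leg13 W * leg12 V : UnitaryOp (H ⊗ᴴ (L ⊗ᴴ H))) =
    leg12 V * leg13 W * leg23 U
  /-- `F` is invariant for `U ⊗ U`: `U₁₃ U₂₃ F₁₂ = F₁₂ U₁₃ U₂₃` on `L ⊗ L ⊗ H`. -/
  right_invariant : (leg13 U * leg23 U * leg12 F : UnitaryOp (L ⊗ᴴ (L ⊗ᴴ H))) =
    leg12 F * leg13 U * leg23 U
  /-- `F` is invariant for `V ⊗ V`: `V₁₃ V₁₂ F₂₃ = F₂₃ V₁₃ V₁₂` on `H ⊗ L ⊗ L`. -/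
  left_invariant : (leg13 V * leg12 V * leg23 F : UnitaryOp (H ⊗ᴴ (L ⊗ᴴ L))) =
    leg23 F * leg13 V * leg12 V
  /-- The braiding `c = Z Σ` on `L ⊗ L` is defined, and `F` satisfies the top-braided pentagon
  equation `F₂₃ F₁₂ = F₁₂ c₂₃ F₁₂ c₂₃* F₂₃` on `L ⊗ L ⊗ L`. -/
  braided_pentagon : ∃ Z : UnitaryOp (L ⊗ᴴ L), IsBraidingUnitary U V Z ∧
    (leg23 F * leg12 F : UnitaryOp (L ⊗ᴴ (L ⊗ᴴ L))) =
      leg12 F * leg23 (Z * comm L L) * leg12 F * leg23 (Z * comm L L)⁻¹ * leg23 F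

/-- `W₁₃ U₂₃` on `H ⊗ L ⊗ H`, viewed on `(H ⊗ L) ⊗ H`. -/
def bicharToBase (W : UnitaryOp (H ⊗ᴴ H)) (U : UnitaryOp (L ⊗ᴴ H)) :
    UnitaryOp ((H ⊗ᴴ L) ⊗ᴴ H) :=
  conj (assoc H L H).symm (leg13 W * leg23 U)

/-- `W₁₂` on `H ⊗ (H ⊗ L)`. -/
def bicharFromBase (W : UnitaryOp (H ⊗ᴴ H)) : UnitaryOp (H ⊗ᴴ (H ⊗ᴴ L)) :=
  leg12 W

/-- `P = W₁₃ U₂₃` on `(H ⊗ L) ⊗ (H ⊗ L)`. -/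
def semidirectProjection (W : UnitaryOp (H ⊗ᴴ H)) (U : UnitaryOp (L ⊗ᴴ H)) :
    UnitaryOp ((H ⊗ᴴ L) ⊗ᴴ (H ⊗ᴴ L)) :=
  leg12 (bicharToBase W U)

/-- The semidirect product `W^C = W₁₃ U₂₃ V₃₄* F₂₄ V₃₄` on `(H ⊗ L) ⊗ (H ⊗ L)`. The factor
`V₃₄* F₂₄ V₃₄` is `1 ⊗ (V₂₃* F₁₃ V₂₃)` on `H ⊗ (L ⊗ H ⊗ L)`. -/
def semidirectUnitary (W : UnitaryOp (H ⊗ᴴ H)) (U : UnitaryOp (L ⊗ᴴ H))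
    (V : UnitaryOp (H ⊗ᴴ L)) (F : UnitaryOp (L ⊗ᴴ L)) :
    UnitaryOp ((H ⊗ᴴ L) ⊗ᴴ (H ⊗ᴴ L)) :=
  semidirectProjection W U *
    conj (assoc H L (H ⊗ᴴ L)).symm
      (map (1 : UnitaryOp H)
        ((leg23 V)⁻¹ * leg13 F * leg23 V : UnitaryOp (L ⊗ᴴ (H ⊗ᴴ L))))

end Definitions

end

open HilbertTensor

noncomputable section

open scoped TensorProduct

namespace HilbertTensor

/-! ### Extensionality on Hilbert tensor products -/

variable {A B C D E : Type*} [NormedAddCommGroup A] [InnerProductSpace ℂ A]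
  [NormedAddCommGroup B] [InnerProductSpace ℂ B] [NormedAddCommGroup C] [InnerProductSpace ℂ C]
  [NormedAddCommGroup D] [InnerProductSpace ℂ D] [NormedAddCommGroup E] [InnerProductSpace ℂ E]

/-! Write `W^C = P Q` with `P = W₁₃ U₂₃` and fibre `Q = V₃₄* F₂₄ V₃₄`, and number the factors of `(H
⊗ L)^{⊗3}` from 1 to 6. The pentagon equation for `W^C` follows from three facts (`word_pentagon`):
`P₂₃` satisfies the left representation relation over `W^C`; `Q₂₃` commutes with `P₁₂`; and `Q₂₃ Q₁₂
= Q₁₂ (P₂₃* Q₁₃ P₂₃) Q₂₃`.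

The first fact (`bicharToBase_leftRep`) combines the pentagon for `W`, the representation property
of `U`, compatibility of `U` with `V`, and `U`-invariance of `F`. The second holds because `P₁₂`
lives on legs 1, 2, 3 and `Q₂₃` on legs 4, 5, 6. The third (`semidirectFibre_pentagon`) is the
braided pentagon on legs 2, 4, 6: conjugation by `V₃₆ V₅₆ V₃₄` carries `Q₁₂`, `Q₂₃` and `P₂₃* Q₁₃
P₂₃` to `F₂₄`, `F₄₆` and `Z₄₆ F₂₆ Z₄₆*`. This uses that `V` is a left representation, compatibility,
`V`-invariance of `F`, and the formula for `Z`.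

The relations for `P` and for the composite come from those of `W₁₃ U₂₃` by appending an inert
factor `L` or by moving commuting factors.

To make leg notation rigorous, operators are rebracketed to the right by the injective map
`flatten`. All leg placements are group homomorphisms, so the hypotheses can be transported to any
legs, and what remains is a set of word identities in an abstract group. -/

theorem norm_tmul (a : A) (b : B) : ‖tmul a b‖ = ‖a‖ * ‖b‖ := by
  rw [tmul, LinearIsometry.norm_map, TensorProduct.norm_tmul]

/-- Tensoring with a fixed vector on the left. -/
def tmulLeft (a : A) : B →L[ℂ] A ⊗ᴴ B :=
  LinearMap.mkContinuous ((incl A B).toLinearMap ∘ₗ TensorProduct.mk ℂ A B a) ‖a‖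
    fun b => (norm_tmul a b).le

/-- Tensoring with a fixed vector on the right. -/
def tmulRight (b : B) : A →L[ℂ] A ⊗ᴴ B :=
  LinearMap.mkContinuous ((incl A B).toLinearMap ∘ₗ (TensorProduct.mk ℂ A B).flip b) ‖b‖
    fun a => ((norm_tmul a b).trans (mul_comm _ _)).le

@[simp] theorem tmulLeft_apply (a : A) (b : B) : tmulLeft a b = tmul a b := rfl

@[simp] theorem tmulRight_apply (a : A) (b : B) : tmulRight b a = tmul a b := rfl

theorem clm_ext {f g : A ⊗ᴴ B →L[ℂ] D} (h : ∀ a b, f (tmul a b) = g (tmul a b)) : f = g := by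
  refine ContinuousLinearMap.coeFn_injective
    (denseRange_incl.equalizer f.continuous g.continuous (funext fun x => ?_))
  induction x using TensorProduct.induction_on with
  | zero => simp
  | tmul a b => exact h a b
  | add x y hx hy =>
    simp only [Function.comp_apply, map_add] at hx hy ⊢
    rw [hx, hy]

theorem clm_ext_left {f g : A ⊗ᴴ B →L[ℂ] D} (h : ∀ a, f ∘L tmulLeft a = g ∘L tmulLeft a) :
    f = g :=
  clm_ext fun a b => DFunLike.congr_fun (h a) b

theorem clm_ext_right {f g : A ⊗ᴴ B →L[ℂ] D} (h : ∀ b, f ∘L tmulRight b = g ∘L tmulRight b) :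
    f = g :=
  clm_ext fun a b => DFunLike.congr_fun (h b) a

theorem equiv_ext {f g : A ≃ₗᵢ[ℂ] D}
    (h : (f.toContinuousLinearEquiv : A →L[ℂ] D) = g.toContinuousLinearEquiv) : f = g :=
  LinearIsometryEquiv.ext fun x => DFunLike.congr_fun h x

attribute [simp] map_tmul comm_tmul assoc_tmul

@[simp] theorem assoc_symm_tmul (a : A) (b : B) (c : C) :
    (assoc A B C).symm (tmul a (tmul b c)) = tmul (tmul a b) c := by
  rw [LinearIsometryEquiv.symm_apply_eq]; simp

theorem equiv_ext₂ {f g : A ⊗ᴴ B ≃ₗᵢ[ℂ] D} (h : ∀ a b, f (tmul a b) = g (tmul a b)) : f = g :=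
  equiv_ext (clm_ext h)

/-- Extensionality on `A ⊗ (B ⊗ C)`. -/
theorem equiv_ext₃ {f g : A ⊗ᴴ (B ⊗ᴴ C) ≃ₗᵢ[ℂ] D}
    (h : ∀ a b c, f (tmul a (tmul b c)) = g (tmul a (tmul b c))) : f = g :=
  equiv_ext (clm_ext_left fun a => clm_ext fun b c => h a b c)

/-- Extensionality on `(A ⊗ B) ⊗ C`. -/
theorem equiv_ext₃' {f g : (A ⊗ᴴ B) ⊗ᴴ C ≃ₗᵢ[ℂ] D}
    (h : ∀ a b c, f (tmul (tmul a b) c) = g (tmul (tmul a b) c)) : f = g :=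
  equiv_ext (clm_ext_right fun c => clm_ext fun a b => h a b c)

/-- Extensionality on `(A ⊗ B) ⊗ (C ⊗ D)`. -/
theorem equiv_ext₄ {f g : (A ⊗ᴴ B) ⊗ᴴ (C ⊗ᴴ D) ≃ₗᵢ[ℂ] E}
    (h : ∀ a b c d, f (tmul (tmul a b) (tmul c d)) = g (tmul (tmul a b) (tmul c d))) : f = g :=
  equiv_ext <| clm_ext_left fun x => clm_ext fun c d => by
    have key : (f.toContinuousLinearEquiv : (A ⊗ᴴ B) ⊗ᴴ (C ⊗ᴴ D) →L[ℂ] E) ∘L tmulRight (tmul c d) =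
        (g.toContinuousLinearEquiv : (A ⊗ᴴ B) ⊗ᴴ (C ⊗ᴴ D) →L[ℂ] E) ∘L tmulRight (tmul c d) :=
      clm_ext fun a b => h a b c d
    exact DFunLike.congr_fun key x

/-! ### Conjugation by isometric isomorphisms -/

theorem map_mul (f f' : UnitaryOp A) (g g' : UnitaryOp B) :
    map (f * f') (g * g') = map f g * map f' g' :=
  equiv_ext₂ fun a b => by simp

theorem conj_op_mul (e : A ≃ₗᵢ[ℂ] B) (S T : UnitaryOp A) : conj e (S * T) = conj e S * conj e T := by
  ext x; simp [conj]

/-- `conj` as a group homomorphism. -/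
def conjHom (e : A ≃ₗᵢ[ℂ] B) : UnitaryOp A →* UnitaryOp B := MonoidHom.mk' (conj e) (conj_op_mul e)

theorem conj_conj (e : A ≃ₗᵢ[ℂ] B) (f : B ≃ₗᵢ[ℂ] C) (T : UnitaryOp A) :
    conj f (conj e T) = conj (e.trans f) T := rfl

theorem conj_op_injective (e : A ≃ₗᵢ[ℂ] B) : Function.Injective (conj e) := fun S T h => by
  ext x; simpa [conj] using DFunLike.congr_fun h (e x)

@[simp] theorem conj_symm_conj (e : A ≃ₗᵢ[ℂ] B) (T : UnitaryOp A) : conj e.symm (conj e T) = T := by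
  ext x; simp [conj]

@[simp] theorem conj_conj_symm (e : A ≃ₗᵢ[ℂ] B) (T : UnitaryOp B) : conj e (conj e.symm T) = T := by
  ext x; simp [conj]

theorem conj_eq_iff {e : A ≃ₗᵢ[ℂ] B} {T : UnitaryOp A} {S : UnitaryOp B} :
    conj e T = S ↔ ∀ x, e (T x) = S (e x) := by
  refine ⟨fun h x => by simp [← h, conj], fun h => ?_⟩
  ext x
  simp [conj, h]

theorem conj_eq_of {e : A ≃ₗᵢ[ℂ] B} {T : UnitaryOp A} {S : UnitaryOp B}
    (h : T.trans e = e.trans S) : conj e T = S :=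
  conj_eq_iff.2 fun x => DFunLike.congr_fun h x

theorem map_one_conj (f : B ≃ₗᵢ[ℂ] D) (T : UnitaryOp B) :
    map (1 : UnitaryOp A) (conj f T) = conj (map (1 : UnitaryOp A) f) (map 1 T) :=
  (conj_eq_of (equiv_ext₂ fun a b => by simp [conj])).symm

theorem map_conj_one (e : A ≃ₗᵢ[ℂ] C) (T : UnitaryOp A) :
    map (conj e T) (1 : UnitaryOp B) = conj (map e (1 : UnitaryOp B)) (map T 1) :=
  (conj_eq_of (equiv_ext₂ fun a b => by simp [conj])).symm

/-! ### Placing operators on legs -/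

/-- The operator `1 ⊗ T`. -/
def prep (T : UnitaryOp B) : UnitaryOp (A ⊗ᴴ B) := map 1 T

/-- Insertion of a third tensor factor on which the operator acts trivially. -/
def ins3 (T : UnitaryOp (A ⊗ᴴ (B ⊗ᴴ C))) : UnitaryOp (A ⊗ᴴ (B ⊗ᴴ (D ⊗ᴴ C))) :=
  conj (assoc A B (D ⊗ᴴ C)) (leg13 (conj (assoc A B C).symm T))

/-- Appending a fourth tensor factor on which the operator acts trivially. -/
def app4 (T : UnitaryOp (A ⊗ᴴ (B ⊗ᴴ C))) : UnitaryOp (A ⊗ᴴ (B ⊗ᴴ (C ⊗ᴴ D))) :=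
  conj (assoc A B (C ⊗ᴴ D)) (leg12 (conj (assoc A B C).symm T))

variable (A B C) in
/-- The isomorphism `a ⊗ (b ⊗ c) ↦ b ⊗ (a ⊗ c)`. -/
def leftComm : A ⊗ᴴ (B ⊗ᴴ C) ≃ₗᵢ[ℂ] B ⊗ᴴ (A ⊗ᴴ C) :=
  ((assoc A B C).symm.trans (map (comm A B) 1)).trans (assoc B A C)

@[simp] theorem leftComm_tmul (a : A) (b : B) (c : C) :
    leftComm A B C (tmul a (tmul b c)) = tmul b (tmul a c) := by
  simp [leftComm]

theorem conj_congr {e f : A ≃ₗᵢ[ℂ] B} (h : e = f) (T : UnitaryOp A) : conj e T = conj f T := by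
  rw [h]

theorem map_map_one (T : UnitaryOp A) :
    map (map T (1 : UnitaryOp B)) (1 : UnitaryOp C) = conj (assoc A B C).symm (map T 1) :=
  (conj_eq_of (equiv_ext₃ fun a b c => by simp)).symm

theorem map_one_eq_conj_comm (T : UnitaryOp B) :
    map (1 : UnitaryOp A) T = conj (comm B A) (map T 1) :=
  (conj_eq_of (equiv_ext₂ fun a b => by simp)).symm

/-- `T ⊗ 1` does not see how the complementary factor is rearranged. Once two leg placements of `T`
are both written as conjugates of `T ⊗ 1`, their equality becomes an equality of permutations of
factors, checked on elementary tensors. -/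
theorem conj_map_one_congr {e : A ⊗ᴴ B ≃ₗᵢ[ℂ] D} {e' : A ⊗ᴴ C ≃ₗᵢ[ℂ] D} (g : B ≃ₗᵢ[ℂ] C)
    (h : e = (map 1 g).trans e') (T : UnitaryOp A) : conj e (map T 1) = conj e' (map T 1) := by
  rw [h, ← conj_conj]
  congr 1
  exact conj_eq_of (equiv_ext₂ fun a b => by simp)

theorem leg13_prep (T : UnitaryOp C) :
    (leg13 (prep T) : UnitaryOp (A ⊗ᴴ (B ⊗ᴴ C))) = prep (prep T) :=
  conj_eq_of (equiv_ext₃ fun a c b => by simp [leg12, conj, prep])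

theorem ins3_leg12 (T : UnitaryOp (A ⊗ᴴ B)) :
    (ins3 (leg12 T) : UnitaryOp (A ⊗ᴴ (B ⊗ᴴ (D ⊗ᴴ C)))) = leg12 T := by
  simp only [ins3, leg13, leg12, map_conj_one, map_map_one, conj_conj]
  exact conj_map_one_congr (comm C D) (equiv_ext₃ fun a b c => by simp) T

theorem ins3_leg13 (T : UnitaryOp (A ⊗ᴴ C)) :
    (ins3 (leg13 T) : UnitaryOp (A ⊗ᴴ (B ⊗ᴴ (D ⊗ᴴ C)))) = leg13 (leg13 T) := by
  simp only [ins3, leg13, leg12, map_conj_one, map_map_one, conj_conj]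
  exact conj_map_one_congr (comm B D) (equiv_ext₄ fun a b c d => by simp) T

theorem ins3_prep (T : UnitaryOp (B ⊗ᴴ C)) :
    (ins3 (prep T) : UnitaryOp (A ⊗ᴴ (B ⊗ᴴ (D ⊗ᴴ C)))) = prep (leg13 T) := by
  simp only [ins3, leg13, leg12, prep, map_one_eq_conj_comm, map_conj_one, map_map_one, conj_conj]
  exact conj_map_one_congr (comm A D) (equiv_ext₄ fun a b c d => by simp) T

theorem app4_leg12 (T : UnitaryOp (A ⊗ᴴ B)) :
    (app4 (leg12 T) : UnitaryOp (A ⊗ᴴ (B ⊗ᴴ (C ⊗ᴴ D)))) = leg12 T := by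
  simp only [app4, leg12, map_conj_one, map_map_one, conj_conj]
  exact conj_map_one_congr 1 (equiv_ext₃ fun a b c => by simp) T

theorem app4_leg13 (T : UnitaryOp (A ⊗ᴴ C)) :
    (app4 (leg13 T) : UnitaryOp (A ⊗ᴴ (B ⊗ᴴ (C ⊗ᴴ D)))) = leg13 (leg12 T) := by
  simp only [app4, leg13, leg12, map_conj_one, map_map_one, conj_conj]
  exact conj_map_one_congr (comm B D) (equiv_ext₄ fun a b c d => by simp) T

theorem app4_prep (T : UnitaryOp (B ⊗ᴴ C)) :
    (app4 (prep T) : UnitaryOp (A ⊗ᴴ (B ⊗ᴴ (C ⊗ᴴ D)))) = prep (leg12 T) := by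
  simp only [app4, leg12, prep, map_one_eq_conj_comm, map_conj_one, map_map_one, conj_conj]
  exact conj_map_one_congr (comm A D) (equiv_ext₄ fun a b c d => by simp) T

/-! ### Leg placements as group homomorphisms -/

theorem prep_mul (S T : UnitaryOp B) :
    (prep (S * T) : UnitaryOp (A ⊗ᴴ B)) = prep S * prep T := by
  rw [prep, prep, prep, ← map_mul, one_mul]

theorem leg12_mul (S T : UnitaryOp (A ⊗ᴴ B)) :
    (leg12 (S * T) : UnitaryOp (A ⊗ᴴ (B ⊗ᴴ C))) = leg12 S * leg12 T := by
  rw [leg12, leg12, leg12, ← conj_op_mul, ← map_mul, one_mul]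

theorem leg13_mul (S T : UnitaryOp (A ⊗ᴴ C)) :
    (leg13 (S * T) : UnitaryOp (A ⊗ᴴ (B ⊗ᴴ C))) = leg13 S * leg13 T := by
  rw [leg13, leg13, leg13, ← conj_op_mul, leg12_mul]

theorem ins3_mul (S T : UnitaryOp (A ⊗ᴴ (B ⊗ᴴ C))) :
    (ins3 (S * T) : UnitaryOp (A ⊗ᴴ (B ⊗ᴴ (D ⊗ᴴ C)))) = ins3 S * ins3 T := by
  simp only [ins3, conj_op_mul, leg13_mul]

theorem app4_mul (S T : UnitaryOp (A ⊗ᴴ (B ⊗ᴴ C))) :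
    (app4 (S * T) : UnitaryOp (A ⊗ᴴ (B ⊗ᴴ (C ⊗ᴴ D)))) = app4 S * app4 T := by
  simp only [app4, conj_op_mul, leg12_mul]

theorem prep_inv (T : UnitaryOp B) : (prep T⁻¹ : UnitaryOp (A ⊗ᴴ B)) = (prep T)⁻¹ :=
  map_inv (MonoidHom.mk' prep prep_mul) T

theorem leg13_inv (T : UnitaryOp (A ⊗ᴴ C)) :
    (leg13 T⁻¹ : UnitaryOp (A ⊗ᴴ (B ⊗ᴴ C))) = (leg13 T)⁻¹ :=
  map_inv (MonoidHom.mk' leg13 leg13_mul) T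

theorem ins3_inv (T : UnitaryOp (A ⊗ᴴ (B ⊗ᴴ C))) :
    (ins3 T⁻¹ : UnitaryOp (A ⊗ᴴ (B ⊗ᴴ (D ⊗ᴴ C)))) = (ins3 T)⁻¹ :=
  map_inv (MonoidHom.mk' ins3 ins3_mul) T

theorem app4_inv (T : UnitaryOp (A ⊗ᴴ (B ⊗ᴴ C))) :
    (app4 T⁻¹ : UnitaryOp (A ⊗ᴴ (B ⊗ᴴ (C ⊗ᴴ D)))) = (app4 T)⁻¹ :=
  map_inv (MonoidHom.mk' app4 app4_mul) T

theorem conj_op_inv (e : A ≃ₗᵢ[ℂ] B) (T : UnitaryOp A) : conj e T⁻¹ = (conj e T)⁻¹ :=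
  map_inv (conjHom e) T

theorem commute_prep {S T : UnitaryOp B} (h : Commute S T) :
    Commute (prep S : UnitaryOp (A ⊗ᴴ B)) (prep T) :=
  h.map (MonoidHom.mk' prep prep_mul)

theorem commute_leg13 {S T : UnitaryOp (A ⊗ᴴ C)} (h : Commute S T) :
    Commute (leg13 S : UnitaryOp (A ⊗ᴴ (B ⊗ᴴ C))) (leg13 T) :=
  h.map (MonoidHom.mk' leg13 leg13_mul)

theorem commute_ins3 {S T : UnitaryOp (A ⊗ᴴ (B ⊗ᴴ C))} (h : Commute S T) :
    Commute (ins3 S : UnitaryOp (A ⊗ᴴ (B ⊗ᴴ (D ⊗ᴴ C)))) (ins3 T) :=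
  h.map (MonoidHom.mk' ins3 ins3_mul)

/-! ### Commutation of operators on disjoint legs -/

/-- `T₁₂` and `S₃` commute. -/
theorem commute_leg12_prep (T : UnitaryOp (A ⊗ᴴ B)) (S : UnitaryOp C) :
    Commute (leg12 T : UnitaryOp (A ⊗ᴴ (B ⊗ᴴ C))) (prep (prep S)) := by
  have h : (prep (prep S) : UnitaryOp (A ⊗ᴴ (B ⊗ᴴ C))) = conj (assoc A B C) (map 1 S) :=
    (conj_eq_of (equiv_ext₃' fun a b c => by simp [prep])).symm
  rw [h, leg12, Commute, SemiconjBy, ← conj_op_mul, ← conj_op_mul, ← map_mul, ← map_mul, one_mul,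
    one_mul, mul_one, mul_one]

/-- `T₁₃` and `S₂` commute. -/
theorem commute_leg13_prep (T : UnitaryOp (A ⊗ᴴ C)) (S : UnitaryOp B) :
    Commute (leg13 T : UnitaryOp (A ⊗ᴴ (B ⊗ᴴ C))) (prep (map S 1)) := by
  have h : (prep (map S 1) : UnitaryOp (A ⊗ᴴ (B ⊗ᴴ C))) =
      conj (map (1 : UnitaryOp A) (comm C B)) (prep (prep S)) :=
    (conj_eq_of (equiv_ext₃ fun a b c => by simp [prep])).symm
  rw [h, leg13]
  exact (commute_leg12_prep T S).map (conjHom _)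

/-- Inserting `B ⊗ C` amounts to inserting `C` and then `B`. -/
theorem conj_assoc_leg13 (T : UnitaryOp (A ⊗ᴴ D)) :
    conj (map (1 : UnitaryOp A) (assoc B C D)) (leg13 T) = leg13 (leg13 T) := by
  simp only [leg13, leg12, map_conj_one, map_map_one, conj_conj]
  exact conj_map_one_congr (comm B C) (equiv_ext₄ fun a b c d => by simp) T

/-- `T₁₄` and `S₂₃` commute. -/
theorem commute_leg13_leg13_prep_leg12 (T : UnitaryOp (A ⊗ᴴ D)) (S : UnitaryOp (B ⊗ᴴ C)) :
    Commute (leg13 (leg13 T) : UnitaryOp (A ⊗ᴴ (B ⊗ᴴ (C ⊗ᴴ D)))) (prep (leg12 S)) := by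
  rw [← conj_assoc_leg13, leg12, prep, map_one_conj]
  exact (commute_leg13_prep T S).map (conjHom _)

/-- `T₁₃` and `S₂₄` commute. -/
theorem commute_leg13_leg12_prep_leg13 (T : UnitaryOp (A ⊗ᴴ C)) (S : UnitaryOp (B ⊗ᴴ D)) :
    Commute (leg13 (leg12 T) : UnitaryOp (A ⊗ᴴ (B ⊗ᴴ (C ⊗ᴴ D)))) (prep (leg13 S)) := by
  -- Exchanging the two middle factors reduces the claim to the disjoint pair `T₁₂`, `S₃₄`.
  have h : (leg13 (leg12 T) : UnitaryOp (A ⊗ᴴ (B ⊗ᴴ (C ⊗ᴴ D)))) =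
      conj (map (1 : UnitaryOp A) (leftComm C B D)) (leg12 T) := by
    simp only [leg13, leg12, map_conj_one, map_map_one, conj_conj]
    exact conj_map_one_congr (comm D B) (equiv_ext₄ fun a b c d => by simp) T
  have h' : (prep (leg13 S) : UnitaryOp (A ⊗ᴴ (B ⊗ᴴ (C ⊗ᴴ D)))) =
      conj (map (1 : UnitaryOp A) (leftComm C B D)) (prep (prep S)) := by
    simp only [leg13, leg12, prep, map_one_eq_conj_comm, map_conj_one, map_map_one, conj_conj]
    exact conj_congr (equiv_ext₄ fun a b c d => by simp) _
  rw [h, h']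
  exact (commute_leg12_prep T S).map (conjHom _)

/-! ### Rebracketing -/

theorem leg23_eq_prep (T : UnitaryOp (B ⊗ᴴ C)) :
    (leg23 T : UnitaryOp (A ⊗ᴴ (B ⊗ᴴ C))) = prep T := rfl

theorem conj_assoc_prep (T : UnitaryOp C) :
    conj (assoc A B C) (prep T) = prep (prep T) :=
  conj_eq_of (equiv_ext₃' fun a b c => by simp [prep])

theorem conj_map_prep (e : B ≃ₗᵢ[ℂ] C) (T : UnitaryOp B) :
    conj (map (1 : UnitaryOp A) e) (prep T) = prep (conj e T) :=
  (map_one_conj e T).symm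

theorem conj_map_map_leg13 (e : C ≃ₗᵢ[ℂ] D) (T : UnitaryOp (A ⊗ᴴ C)) :
    conj (map (1 : UnitaryOp A) (map (1 : UnitaryOp B) e)) (leg13 T) =
      leg13 (conj (map (1 : UnitaryOp A) e) T) := by
  simp only [leg13, leg12, map_conj_one, conj_conj]
  exact conj_map_one_congr 1 (equiv_ext₃' fun a b c => by simp) T

theorem conj_assoc_leg12 (T : UnitaryOp (A ⊗ᴴ (B ⊗ᴴ C))) :
    conj (map (1 : UnitaryOp A) (assoc B C D)) (leg12 T) = app4 T := by
  simp only [app4, leg12, map_conj_one, conj_conj]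
  refine conj_map_one_congr 1 (equiv_ext ?_) T
  -- The source is `(A ⊗ (B ⊗ C)) ⊗ D`, so density of elementary tensors is applied one factor at a
  -- time.
  exact clm_ext_right fun d => clm_ext_left fun a => clm_ext fun b c => by simp

theorem conj_assoc_leg12' (T : UnitaryOp ((A ⊗ᴴ B) ⊗ᴴ C)) :
    conj (assoc A B (C ⊗ᴴ D)) (leg12 T) = app4 (conj (assoc A B C) T) := by
  rw [app4, conj_symm_conj]

theorem conj_assoc_leg13' (T : UnitaryOp ((A ⊗ᴴ B) ⊗ᴴ C)) :
    conj (assoc A B (D ⊗ᴴ C)) (leg13 T) = ins3 (conj (assoc A B C) T) := by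
  rw [ins3, conj_symm_conj]

/-- Testing on `x ⊗ b` with a fixed `b ≠ 0` suffices, since the norm is multiplicative on elementary
tensors. This gives uniqueness of the composite bicharacter. -/
theorem leg13_injective [Nontrivial B] :
    Function.Injective (leg13 : UnitaryOp (A ⊗ᴴ C) → UnitaryOp (A ⊗ᴴ (B ⊗ᴴ C))) := by
  intro S T h
  obtain ⟨b, hb⟩ := exists_ne (0 : B)
  have h' := conj_op_injective _ (conj_op_injective _ h)
  ext x
  have hx : tmul (S x) b = tmul (T x) b := by
    simpa using DFunLike.congr_fun h' (tmul x b)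
  rw [← sub_eq_zero, ← norm_eq_zero] at hx ⊢
  have : tmul (S x) b - tmul (T x) b = tmul (S x - T x) b := (map_sub (tmulRight b) _ _).symm
  rw [this, norm_tmul] at hx
  exact (mul_eq_zero.1 hx).resolve_right (norm_ne_zero_iff.2 hb)

/-- Covers the degenerate case `H = 0`, which `leg13_injective` excludes. -/
instance [Subsingleton A] : Subsingleton (A ⊗ᴴ B) :=
  subsingleton_of_forall_eq 0 fun x => by
    have h : ContinuousLinearMap.id ℂ (A ⊗ᴴ B) = 0 := clm_ext fun a b => by
      rw [Subsingleton.elim a 0]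
      exact map_zero (tmulRight b)
    exact DFunLike.congr_fun h x

/-- Rebracketing of `(A ⊗ B) ⊗ ((C ⊗ D) ⊗ E)` to the right. -/
def flatten (T : UnitaryOp ((A ⊗ᴴ B) ⊗ᴴ ((C ⊗ᴴ D) ⊗ᴴ E))) :
    UnitaryOp (A ⊗ᴴ (B ⊗ᴴ (C ⊗ᴴ (D ⊗ᴴ E)))) :=
  conj (map 1 (map 1 (assoc C D E))) (conj (assoc A B ((C ⊗ᴴ D) ⊗ᴴ E)) T)

theorem flatten_mul (S T : UnitaryOp ((A ⊗ᴴ B) ⊗ᴴ ((C ⊗ᴴ D) ⊗ᴴ E))) :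
    flatten (S * T) = flatten S * flatten T := by
  simp only [flatten, conj_op_mul]

theorem flatten_inv (T : UnitaryOp ((A ⊗ᴴ B) ⊗ᴴ ((C ⊗ᴴ D) ⊗ᴴ E))) :
    flatten T⁻¹ = (flatten T)⁻¹ := by
  simp only [flatten, conj_op_inv]

theorem flatten_injective : Function.Injective
    (flatten : UnitaryOp ((A ⊗ᴴ B) ⊗ᴴ ((C ⊗ᴴ D) ⊗ᴴ E)) → _) :=
  (conj_op_injective _).comp (conj_op_injective _)

theorem flatten_leg23 (T : UnitaryOp ((C ⊗ᴴ D) ⊗ᴴ E)) :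
    flatten (leg23 T : UnitaryOp ((A ⊗ᴴ B) ⊗ᴴ ((C ⊗ᴴ D) ⊗ᴴ E))) =
      prep (prep (conj (assoc C D E) T)) := by
  rw [flatten, leg23_eq_prep, conj_assoc_prep, conj_map_prep, conj_map_prep]

end HilbertTensor

/-! ### Word identities in a group -/

section words

variable {G : Type*} [Group G]

theorem word_projection {w13 w15 w35 u23 u25 : G} (h135 : w35 * w13 = w13 * w15 * w35)
    (h235 : w35 * u23 = u23 * u25 * w35) (c₁ : Commute w15 u23) :
    w35 * (w13 * u23) = w13 * u23 * (w15 * u25) * w35 := by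
  rw [← mul_assoc, h135, mul_assoc, h235, mul_assoc w13 w15, ← mul_assoc w15, ← mul_assoc w15,
    c₁.eq]
  simp only [mul_assoc]

/-- Crossing `W₁₃ U₂₃` leaves `W₁₅ U₂₅` behind. Compatibility carries `W₃₅ U₄₅` across `V₃₄*` in the
reversed order `U₄₅ W₃₅`, invariance carries `U₂₅ U₄₅` across `F₂₄`, and compatibility across `V₃₄`
restores the order. -/
theorem word_leftRep {w13 w15 w35 u23 u25 u45 v34 f24 : G}
    (h135 : w35 * w13 = w13 * w15 * w35) (h235 : w35 * u23 = u23 * u25 * w35)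
    (h345 : u45 * w35 * v34 = v34 * w35 * u45) (h245 : u25 * u45 * f24 = f24 * u25 * u45)
    (c₁ : Commute w15 u23) (c₂ : Commute u45 w13) (c₃ : Commute u45 u23) (c₄ : Commute w35 f24)
    (c₅ : Commute w15 v34) (c₆ : Commute u25 v34) (c₇ : Commute w15 f24) :
    w35 * u45 * (w13 * u23 * (v34⁻¹ * f24 * v34)) =
      w13 * u23 * (v34⁻¹ * f24 * v34) * (w15 * u25) * (w35 * u45) := by
  have h345' : w35 * u45 * v34⁻¹ = v34⁻¹ * (u45 * w35) := by
    rw [eq_inv_mul_iff_mul_eq, ← mul_assoc, ← mul_assoc, ← h345, mul_inv_cancel_right]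
  calc w35 * u45 * (w13 * u23 * (v34⁻¹ * f24 * v34))
      = w35 * (w13 * u23) * u45 * (v34⁻¹ * f24 * v34) := by
        rw [mul_assoc w35, ← mul_assoc u45, (c₂.mul_right c₃).eq]
        simp only [mul_assoc]
    _ = w13 * u23 * (w15 * u25) * (w35 * u45 * v34⁻¹) * f24 * v34 := by
        rw [word_projection h135 h235 c₁]
        simp only [mul_assoc]
    _ = w13 * u23 * ((w15 * u25) * v34⁻¹) * u45 * (w35 * f24) * v34 := by
        rw [h345']
        simp only [mul_assoc]
    _ = w13 * u23 * v34⁻¹ * w15 * (u25 * u45 * f24) * w35 * v34 := by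
        rw [((c₅.mul_left c₆).inv_right).eq, c₄.eq]
        simp only [mul_assoc]
    _ = w13 * u23 * v34⁻¹ * (w15 * f24) * u25 * (u45 * w35 * v34) := by
        rw [h245]
        simp only [mul_assoc]
    _ = w13 * u23 * v34⁻¹ * f24 * (w15 * u25 * v34) * w35 * u45 := by
        rw [h345, c₇.eq]
        simp only [mul_assoc]
    _ = w13 * u23 * (v34⁻¹ * f24 * v34) * (w15 * u25) * (w35 * u45) := by
        rw [(c₅.mul_left c₆).eq]
        simp only [mul_assoc]

/-- This says that the braiding intertwines the left representations. Since `V₃₆ V₅₆ = W₃₅* V₅₆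
W₃₅`, the factor `W₃₅` can be pushed through the word for `Z₄₆`, using compatibility at `U₄₅`; the
surviving conjugation by `W₃₅` is trivial because `Z₄₆` lives on other legs. -/
theorem word_braiding_leftRep {w35 u45 v34 v36 v56 z46 : G}
    (h345 : u45 * w35 * v34 = v34 * w35 * u45) (h356 : v56 * w35 = w35 * v36 * v56)
    (h456 : z46 = v56 * u45⁻¹ * v56⁻¹ * u45)
    (c₁ : Commute v34 v56) (c₂ : Commute v36 u45) (c₃ : Commute w35 z46) :
    v36 * v34 * z46 = z46 * v34 * v36 := by
  have h₁ : v36 * v56 = w35⁻¹ * v56 * w35 := by rw [mul_assoc, h356]; group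
  have h₂ : w35 * v34 * u45⁻¹ = u45⁻¹ * v34 * w35 := by
    rw [mul_inv_eq_iff_eq_mul, mul_assoc, mul_assoc, eq_inv_mul_iff_mul_eq, ← mul_assoc, h345,
      mul_assoc]
  have h₃ : w35 * v56⁻¹ = v56⁻¹ * w35 * v36 := by
    rw [mul_inv_eq_iff_eq_mul, mul_assoc, mul_assoc, eq_inv_mul_iff_mul_eq, h356, mul_assoc]
  calc v36 * v34 * z46 = v36 * (v34 * v56) * u45⁻¹ * v56⁻¹ * u45 := by
        rw [h456]; simp only [mul_assoc]
    _ = w35⁻¹ * v56 * (w35 * v34 * u45⁻¹) * v56⁻¹ * u45 := by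
        rw [c₁.eq, ← mul_assoc, h₁]; simp only [mul_assoc]
    _ = w35⁻¹ * v56 * u45⁻¹ * v34 * (w35 * v56⁻¹) * u45 := by
        rw [h₂]; simp only [mul_assoc]
    _ = w35⁻¹ * v56 * u45⁻¹ * (v34 * v56⁻¹) * w35 * (v36 * u45) := by
        rw [h₃]; simp only [mul_assoc]
    _ = w35⁻¹ * v56 * u45⁻¹ * v56⁻¹ * (v34 * w35 * u45) * v36 := by
        rw [c₁.inv_right.eq, c₂.eq]; simp only [mul_assoc]
    _ = w35⁻¹ * z46 * w35 * v34 * v36 := by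
        rw [← h345, h456]; simp only [mul_assoc]
    _ = z46 * v34 * v36 := by rw [mul_assoc w35⁻¹, ← c₃.eq, inv_mul_cancel_left]

/-- With `a = V₃₆ V₅₆`, all three fibre operators are conjugates by `a V₃₄` of the operators in the
braided pentagon `h246`. -/
theorem word_braided_pentagon {w35 u45 v34 v36 v56 z46 f24 f26 f46 : G}
    (h345 : u45 * w35 * v34 = v34 * w35 * u45) (h356 : v56 * w35 = w35 * v36 * v56)
    (h456 : z46 = v56 * u45⁻¹ * v56⁻¹ * u45) (h346 : v36 * v34 * f46 = f46 * v36 * v34)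
    (h246 : f46 * f24 = f24 * (z46 * f26 * z46⁻¹) * f46)
    (c₁ : Commute v34 v56) (c₂ : Commute v36 u45) (c₃ : Commute w35 z46) (c₄ : Commute w35 f26)
    (c₅ : Commute v34 f26) (c₆ : Commute u45 f26) (c₇ : Commute f24 v36) (c₈ : Commute f24 v56) :
    v56⁻¹ * f46 * v56 * (v34⁻¹ * f24 * v34) =
      v34⁻¹ * f24 * v34 * ((w35 * u45)⁻¹ * (v56⁻¹ * f26 * v56) * (w35 * u45)) *
        (v56⁻¹ * f46 * v56) := by
  set a := v36 * v56 with ha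
  have hz := word_braiding_leftRep h345 h356 h456 c₁ c₂ c₃
  -- `F₂₆` commutes with `V₃₄ U₄₅*`, so conjugating it by `Z₄₆` is the same as conjugating it by
  -- `Z₄₆ V₃₄ U₄₅*`, which is the `a`-conjugate of `V₃₄ U₄₅*`. This is where the braiding enters.
  have hE : a * v34 * u45⁻¹ * a⁻¹ = z46 * (v34 * u45⁻¹) := by
    calc a * v34 * u45⁻¹ * a⁻¹ = v36 * (v34 * v56) * u45⁻¹ * v56⁻¹ * v36⁻¹ := by
          rw [c₁.eq, ha, mul_inv_rev]; simp only [mul_assoc]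
      _ = v36 * v34 * (v56 * u45⁻¹ * v56⁻¹ * u45) * (u45⁻¹ * v36⁻¹) := by group
      _ = z46 * (v34 * u45⁻¹) := by
          rw [← h456, hz, ← c₂.inv_inv.eq, mul_assoc, mul_inv_cancel_left, mul_assoc]
  have hM : v34 * ((w35 * u45)⁻¹ * (v56⁻¹ * f26 * v56) * (w35 * u45)) =
      a⁻¹ * (z46 * f26 * z46⁻¹) * a * v34 := by
    have h₁ : v56 * w35 = w35 * a := by rw [h356, mul_assoc]
    have h₂ : (w35 * u45)⁻¹ * (v56⁻¹ * f26 * v56) * (w35 * u45) =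
        u45⁻¹ * a⁻¹ * f26 * a * u45 := by
      calc _ = u45⁻¹ * (v56 * w35)⁻¹ * f26 * (v56 * w35) * u45 := by group
        _ = u45⁻¹ * a⁻¹ * w35⁻¹ * (f26 * w35) * a * u45 := by rw [h₁]; group
        _ = _ := by rw [← c₄.eq]; group
    have h₃ : z46 * f26 * z46⁻¹ = (a * v34 * u45⁻¹ * a⁻¹) * f26 * (a * v34 * u45⁻¹ * a⁻¹)⁻¹ := by
      rw [hE, mul_assoc z46 (v34 * u45⁻¹) f26, (c₅.mul_left c₆.inv_left).eq]
      group
    rw [h₂, h₃]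
    group
  have hQ : v34 * (v56⁻¹ * f46 * v56) = a⁻¹ * f46 * a * v34 := by
    calc v34 * (v56⁻¹ * f46 * v56) = v34 * v56⁻¹ * f46 * v56 := by simp only [mul_assoc]
      _ = v56⁻¹ * v36⁻¹ * (v36 * v34 * f46) * v56 := by rw [c₁.inv_right.eq]; group
      _ = v56⁻¹ * v36⁻¹ * f46 * v36 * (v34 * v56) := by rw [h346]; simp only [mul_assoc]
      _ = a⁻¹ * f46 * a * v34 := by rw [c₁.eq, ha]; group
  have cA : Commute f24 a := c₇.mul_right c₈
  symm
  calc _ = v34⁻¹ * f24 * (v34 * ((w35 * u45)⁻¹ * (v56⁻¹ * f26 * v56) * (w35 * u45))) *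
        (v56⁻¹ * f46 * v56) := by simp only [mul_assoc]
    _ = v34⁻¹ * f24 * (a⁻¹ * (z46 * f26 * z46⁻¹) * a) * (v34 * (v56⁻¹ * f46 * v56)) := by
        rw [hM]; simp only [mul_assoc]
    _ = v34⁻¹ * (f24 * a⁻¹) * (z46 * f26 * z46⁻¹) * f46 * a * v34 := by rw [hQ]; group
    _ = v34⁻¹ * a⁻¹ * (f46 * f24) * a * v34 := by
        rw [cA.inv_right.eq, h246]; simp only [mul_assoc]
    _ = v34⁻¹ * a⁻¹ * f46 * (f24 * a) * v34 := by simp only [mul_assoc]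
    _ = v34⁻¹ * (a⁻¹ * f46 * a * v34) * (v34⁻¹ * f24 * v34) := by rw [cA.eq]; group
    _ = v56⁻¹ * f46 * v56 * (v34⁻¹ * f24 * v34) := by rw [← hQ, inv_mul_cancel_left]

/-- The `P₂₃*` in the twisted term `P₂₃* Q₁₃ P₂₃` cancels the `P₂₃` that emerges once `P₂₃` has
crossed `P₁₂ Q₁₂`. -/
theorem word_pentagon {p12 p13 p23 q12 q13 q23 : G}
    (hl : p23 * (p12 * q12) = p12 * q12 * p13 * p23)
    (hq : q23 * q12 = q12 * (p23⁻¹ * q13 * p23) * q23) (c : Commute q23 p12) :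
    p23 * q23 * (p12 * q12) = p12 * q12 * (p13 * q13) * (p23 * q23) := by
  calc p23 * q23 * (p12 * q12) = p23 * (q23 * p12) * q12 := by simp only [mul_assoc]
    _ = p23 * p12 * (q23 * q12) := by rw [c.eq]; simp only [mul_assoc]
    _ = p23 * (p12 * q12) * (p23⁻¹ * q13 * p23) * q23 := by rw [hq]; simp only [mul_assoc]
    _ = _ := by rw [hl]; group

end words

/-! ### The semidirect product and its factors in leg notation -/

section semidirect

variable {H L E : Type*} [NormedAddCommGroup H] [InnerProductSpace ℂ H]
  [NormedAddCommGroup L] [InnerProductSpace ℂ L] [NormedAddCommGroup E] [InnerProductSpace ℂ E]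
  {W : UnitaryOp (H ⊗ᴴ H)} {U : UnitaryOp (L ⊗ᴴ H)} {V : UnitaryOp (H ⊗ᴴ L)}
  {F : UnitaryOp (L ⊗ᴴ L)}

/-- The factor `V₃₄* F₂₄ V₃₄` of the semidirect product. -/
def semidirectFibre (V : UnitaryOp (H ⊗ᴴ L)) (F : UnitaryOp (L ⊗ᴴ L)) :
    UnitaryOp ((H ⊗ᴴ L) ⊗ᴴ (H ⊗ᴴ L)) :=
  conj (assoc H L (H ⊗ᴴ L)).symm (prep ((prep V)⁻¹ * leg13 F * prep V))

theorem semidirectUnitary_eq : semidirectUnitary W U V F =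
    semidirectProjection W U * semidirectFibre V F := rfl

theorem conj_assoc_bicharToBase :
    conj (assoc H L H) (bicharToBase W U) = leg13 W * prep U := by
  rw [bicharToBase, conj_conj_symm, leg23_eq_prep]

theorem conj_assoc_semidirectProjection :
    conj (assoc H L (H ⊗ᴴ L)) (semidirectProjection W U) = leg13 (leg12 W) * prep (leg12 U) := by
  rw [semidirectProjection, conj_assoc_leg12', conj_assoc_bicharToBase, app4_mul, app4_leg13,
    app4_prep]

theorem conj_assoc_semidirectFibre : conj (assoc H L (H ⊗ᴴ L)) (semidirectFibre V F) =
    (prep (prep V))⁻¹ * prep (leg13 F) * prep (prep V) := by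
  rw [semidirectFibre, conj_conj_symm, prep_mul, prep_mul, prep_inv]

theorem flatten_leg12_projection :
    flatten (leg12 (semidirectProjection W U) : UnitaryOp ((H ⊗ᴴ L) ⊗ᴴ ((H ⊗ᴴ L) ⊗ᴴ E))) =
      leg13 (leg12 W) * prep (leg12 U) := by
  simp only [flatten, conj_assoc_leg12', conj_assoc_semidirectProjection, app4_mul, app4_leg13,
    app4_prep, conj_op_mul, conj_map_map_leg13, conj_map_prep, conj_assoc_leg12, app4_leg12]

theorem flatten_leg12_fibre :
    flatten (leg12 (semidirectFibre V F) : UnitaryOp ((H ⊗ᴴ L) ⊗ᴴ ((H ⊗ᴴ L) ⊗ᴴ E))) =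
      (prep (prep (leg12 V)))⁻¹ * prep (leg13 (leg12 F)) * prep (prep (leg12 V)) := by
  simp only [flatten, conj_assoc_leg12', conj_assoc_semidirectFibre, app4_mul, app4_inv,
    app4_prep, conj_op_mul, conj_op_inv, conj_map_prep, conj_assoc_leg12, app4_leg13]

theorem flatten_leg13_bicharToBase :
    flatten (leg13 (bicharToBase W U) : UnitaryOp ((H ⊗ᴴ L) ⊗ᴴ ((H ⊗ᴴ L) ⊗ᴴ H))) =
      leg13 (leg13 (leg13 W)) * prep (leg13 (leg13 U)) := by
  simp only [flatten, conj_assoc_leg13', conj_assoc_bicharToBase, ins3_mul, ins3_leg13,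
    ins3_prep, conj_op_mul, conj_map_map_leg13, conj_map_prep, conj_assoc_leg13]

theorem flatten_leg13_projection : flatten (leg13 (semidirectProjection W U) :
      UnitaryOp ((H ⊗ᴴ L) ⊗ᴴ ((H ⊗ᴴ L) ⊗ᴴ (H ⊗ᴴ L)))) =
      leg13 (leg13 (leg13 (leg12 W))) * prep (leg13 (leg13 (leg12 U))) := by
  simp only [flatten, conj_assoc_leg13', conj_assoc_semidirectProjection, ins3_mul, ins3_leg13,
    ins3_prep, conj_op_mul, conj_map_map_leg13, conj_map_prep, conj_assoc_leg13]

theorem flatten_leg13_fibre : flatten (leg13 (semidirectFibre V F) :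
      UnitaryOp ((H ⊗ᴴ L) ⊗ᴴ ((H ⊗ᴴ L) ⊗ᴴ (H ⊗ᴴ L)))) =
      (prep (prep (prep (prep V))))⁻¹ * prep (leg13 (leg13 (leg13 F))) *
        prep (prep (prep (prep V))) := by
  simp only [flatten, conj_assoc_leg13', conj_assoc_semidirectFibre, ins3_mul, ins3_inv,
    ins3_prep, conj_op_mul, conj_op_inv, conj_map_prep, conj_assoc_leg13, leg13_prep,
    conj_assoc_prep]

/-! ### Representation relations for the bicharacters and the projection -/

theorem bicharToBase_rightRep (hW : IsMultiplicativeUnitary W) (hU : IsRightRep W U) :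
    IsRightRep W (bicharToBase W U) := by
  apply conj_op_injective (assoc H L (H ⊗ᴴ H))
  simp only [conj_op_mul, leg23_eq_prep, conj_assoc_prep, conj_assoc_leg12', conj_assoc_leg13',
    conj_assoc_bicharToBase, app4_mul, ins3_mul, app4_leg13, app4_prep, ins3_leg13, ins3_prep]
  -- Here the space is `H ⊗ L ⊗ H ⊗ H`, so the label 5 of the word identity stands for the fourth
  -- factor.
  refine word_projection ?_ ?_ (commute_leg13_leg13_prep_leg12 W U)
  · simpa only [leg13_mul, leg23_eq_prep, leg13_prep] using congrArg leg13 hW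
  · simpa only [prep_mul, leg23_eq_prep] using congrArg prep hU

theorem bicharToBase_leftRep (hF : IsBraidedMultiplicativeUnitary W U V F) :
    IsLeftRep (semidirectUnitary W U V F) (bicharToBase W U) := by
  apply flatten_injective
  simp only [flatten_mul, semidirectUnitary_eq, leg12_mul, flatten_leg23, conj_assoc_bicharToBase,
    flatten_leg12_projection, flatten_leg12_fibre, flatten_leg13_bicharToBase, prep_mul]
  refine word_leftRep ?_ ?_ ?_ ?_ (commute_leg13_leg13_prep_leg12 _ _) ?_ ?_ ?_ ?_ ?_ ?_
  · simpa only [ins3_mul, leg13_mul, leg23_eq_prep, leg13_prep, ins3_leg12, ins3_leg13, ins3_prep]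
      using congrArg (fun T => (leg13 (ins3 T) :
        UnitaryOp (H ⊗ᴴ (L ⊗ᴴ (H ⊗ᴴ (L ⊗ᴴ H)))))) hF.multiplicative
  · simpa only [ins3_mul, prep_mul, leg23_eq_prep, ins3_leg12, ins3_leg13, ins3_prep]
      using congrArg (fun T => (prep (ins3 T) :
        UnitaryOp (H ⊗ᴴ (L ⊗ᴴ (H ⊗ᴴ (L ⊗ᴴ H)))))) hF.rightRep
  · simpa only [prep_mul, leg23_eq_prep] using congrArg (fun T => (prep (prep T) :
        UnitaryOp (H ⊗ᴴ (L ⊗ᴴ (H ⊗ᴴ (L ⊗ᴴ H)))))) hF.compatible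
  · simpa only [prep_mul, leg13_mul, leg23_eq_prep, leg13_prep]
      using congrArg (fun T => (prep (leg13 T) :
        UnitaryOp (H ⊗ᴴ (L ⊗ᴴ (H ⊗ᴴ (L ⊗ᴴ H)))))) hF.right_invariant
  · simpa only [leg13_prep] using (commute_leg13 (commute_leg12_prep W U)).symm
  · exact (commute_prep (commute_leg12_prep U U)).symm
  · exact (commute_prep (commute_leg13_leg12_prep_leg13 F W)).symm
  · simpa only [leg13_prep] using commute_leg13 (commute_leg13_leg13_prep_leg12 W V)
  · exact commute_prep (commute_leg13_leg13_prep_leg12 U V)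
  · simpa only [ins3_leg13, ins3_prep] using commute_ins3 (commute_leg13_leg13_prep_leg12 W F)

theorem flatten_leg23_projection : flatten (leg23 (semidirectProjection W U) :
      UnitaryOp ((H ⊗ᴴ L) ⊗ᴴ ((H ⊗ᴴ L) ⊗ᴴ (H ⊗ᴴ L)))) =
      prep (prep (leg13 (leg12 W))) * prep (prep (prep (leg12 U))) := by
  rw [flatten_leg23, conj_assoc_semidirectProjection, prep_mul, prep_mul]

theorem flatten_leg23_fibre : flatten (leg23 (semidirectFibre V F) :
      UnitaryOp ((H ⊗ᴴ L) ⊗ᴴ ((H ⊗ᴴ L) ⊗ᴴ (H ⊗ᴴ L)))) =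
      (prep (prep (prep (prep V))))⁻¹ * prep (prep (prep (leg13 F))) *
        prep (prep (prep (prep V))) := by
  simp only [flatten_leg23, conj_assoc_semidirectFibre, prep_mul, prep_inv]

/-- Operators on the fourth tensor factor onwards commute with `P₁₂`. -/
theorem commute_projection_prep (T : UnitaryOp (L ⊗ᴴ E)) :
    Commute (leg13 (leg12 W) * prep (leg12 U) : UnitaryOp (H ⊗ᴴ (L ⊗ᴴ (H ⊗ᴴ (L ⊗ᴴ E)))))
      (prep (prep (prep T))) := by
  refine Commute.mul_left ?_ (commute_prep (commute_leg12_prep U T))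
  simpa only [leg13_prep] using commute_leg13 (B := L) (commute_leg12_prep W T)

theorem commute_fibre_projection : Commute
    (leg23 (semidirectFibre V F) : UnitaryOp ((H ⊗ᴴ L) ⊗ᴴ ((H ⊗ᴴ L) ⊗ᴴ (H ⊗ᴴ L))))
    (leg12 (semidirectProjection W U)) := by
  apply flatten_injective
  rw [flatten_mul, flatten_mul, flatten_leg12_projection, flatten_leg23_fibre]
  simp only [← prep_mul, ← prep_inv]
  exact (commute_projection_prep _).symm.eq

theorem projection_idempotent (hW : IsMultiplicativeUnitary W) (hU : IsRightRep W U) :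
    IsMultiplicativeUnitary (semidirectProjection W U) := by
  apply flatten_injective
  simp only [flatten_mul, flatten_leg12_projection, flatten_leg13_projection,
    flatten_leg23_projection]
  have h135 := congrArg (fun T => (leg13 (ins3 (app4 T)) :
    UnitaryOp (H ⊗ᴴ (L ⊗ᴴ (H ⊗ᴴ (L ⊗ᴴ (H ⊗ᴴ L))))))) hW
  have h235 := congrArg (fun T => (prep (ins3 (app4 T)) :
    UnitaryOp (H ⊗ᴴ (L ⊗ᴴ (H ⊗ᴴ (L ⊗ᴴ (H ⊗ᴴ L))))))) hU
  simp only [app4_mul, ins3_mul, leg13_mul, prep_mul, leg23_eq_prep, leg13_prep, ins3_leg12,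
    ins3_leg13, ins3_prep, app4_leg12, app4_leg13, app4_prep] at h135 h235
  have key := word_projection h135 h235 (commute_leg13_leg13_prep_leg12 _ _)
  -- `P₂₃ = W₃₅ U₄₅`, and its factor `U₄₅` passes through `P₁₂`, which acts on legs 1, 2, 3.
  rw [mul_assoc, ← (commute_projection_prep (leg12 U)).eq, ← mul_assoc, key, mul_assoc]

/-- `P` is `W₁₃ U₂₃` with an inert factor `L` appended, so `app4` transports the relation already
known over the base. -/
theorem projection_leftRep (hF : IsBraidedMultiplicativeUnitary W U V F) :
    IsLeftRep (semidirectUnitary W U V F) (semidirectProjection W U) := by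
  simpa only [IsLeftRep, bicharFromBase, semidirectProjection, app4_mul, leg23_eq_prep, app4_leg12,
    app4_leg13, app4_prep] using
    congrArg (fun T => (app4 T : UnitaryOp ((H ⊗ᴴ L) ⊗ᴴ ((H ⊗ᴴ L) ⊗ᴴ (H ⊗ᴴ L)))))
      (bicharToBase_leftRep hF)

theorem projection_rightRep (hW : IsMultiplicativeUnitary W) (hU : IsRightRep W U) :
    IsRightRep (semidirectUnitary W U V F) (semidirectProjection W U) := by
  have h := projection_idempotent hW hU
  rw [IsMultiplicativeUnitary] at h
  rw [IsRightRep, semidirectUnitary_eq, leg23_eq_prep, prep_mul, ← leg23_eq_prep, ← leg23_eq_prep,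
    mul_assoc, commute_fibre_projection.eq, ← mul_assoc, h]
  simp only [mul_assoc]

/-- On `H ⊗ H ⊗ L ⊗ H ⊗ L` only the factor `W₂₄` of `W^C` meets `W₁₂`; all other factors live on
legs 3, 4, 5. The relation is therefore the pentagon for `W` on legs 1, 2, 4. -/
theorem bicharFromBase_rightRep (hW : IsMultiplicativeUnitary W) :
    IsRightRep (semidirectUnitary W U V F) (bicharFromBase W) := by
  apply conj_op_injective (map (1 : UnitaryOp H) (assoc H L (H ⊗ᴴ L)))
  have hWC : conj (assoc H L (H ⊗ᴴ L)) (semidirectUnitary W U V F) = leg13 (leg12 W) *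
      prep (leg12 U * ((prep V)⁻¹ * leg13 F * prep V)) := by
    rw [semidirectUnitary_eq, conj_op_mul, conj_assoc_semidirectProjection,
      conj_assoc_semidirectFibre]
    simp only [prep_mul, prep_inv, mul_assoc]
  have h := congrArg (fun T => (ins3 (app4 T) : UnitaryOp (H ⊗ᴴ (H ⊗ᴴ (L ⊗ᴴ (H ⊗ᴴ L)))))) hW
  simp only [app4_mul, ins3_mul, leg23_eq_prep, ins3_leg12, ins3_leg13, ins3_prep, app4_leg12,
    app4_leg13, app4_prep] at h
  rw [conj_op_mul, conj_op_mul, conj_op_mul, leg23_eq_prep, conj_map_prep, hWC, bicharFromBase,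
    conj_assoc_leg12, app4_leg12, conj_assoc_leg13, prep_mul, mul_assoc,
    ← (commute_leg12_prep W _).eq, ← mul_assoc, h, mul_assoc]

theorem bicharFromBase_leftRep (hW : IsMultiplicativeUnitary W) :
    IsLeftRep W (bicharFromBase W : UnitaryOp (H ⊗ᴴ (H ⊗ᴴ L))) := by
  simpa only [IsLeftRep, bicharFromBase, semidirectProjection, app4_mul, leg23_eq_prep, app4_leg12,
    app4_leg13, app4_prep] using
    congrArg (fun T => (app4 T : UnitaryOp (H ⊗ᴴ (H ⊗ᴴ (H ⊗ᴴ L))))) hW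

/-- The defining relation is the right representation relation of `W₁₃ U₂₃` over `W` with a factor
`L` appended. -/
theorem bicharFromBase_composite (hW : IsMultiplicativeUnitary W) (hU : IsRightRep W U) :
    IsCompositeBicharacter (bicharToBase W U) (bicharFromBase W) (semidirectProjection W U) := by
  have h : (leg23 (bicharFromBase W) * leg12 (bicharToBase W U) :
      UnitaryOp ((H ⊗ᴴ L) ⊗ᴴ (H ⊗ᴴ (H ⊗ᴴ L)))) =
      leg12 (bicharToBase W U) * leg13 (semidirectProjection W U) * leg23 (bicharFromBase W) := by
    simpa only [IsLeftRep, bicharFromBase, semidirectProjection, app4_mul, leg23_eq_prep, app4_leg12,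
    app4_leg13, app4_prep] using
      congrArg (fun T => (app4 T : UnitaryOp ((H ⊗ᴴ L) ⊗ᴴ (H ⊗ᴴ (H ⊗ᴴ L)))))
        (bicharToBase_rightRep hW hU)
  intro Z
  refine ⟨fun hZ => ?_, fun hZ => hZ ▸ h⟩
  -- If `H = 0`, the middle leg carries no information, but the operators compared also act on the
  -- zero space.
  rcases subsingleton_or_nontrivial H with _ | _
  · exact LinearIsometryEquiv.ext fun x => Subsingleton.elim _ _
  · exact leg13_injective (B := H) (mul_left_cancel (mul_right_cancel (hZ.symm.trans h)))

/-! ### The twisted pentagon equation for the fibre -/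

/-- The braided pentagon equation with the flip absorbed: `F₂₃ F₁₂ = F₁₂ Z₂₃ F₁₃ Z₂₃* F₂₃`. -/
theorem braided_pentagon_flip {Z : UnitaryOp (L ⊗ᴴ L)}
    (h : (leg23 F * leg12 F : UnitaryOp (L ⊗ᴴ (L ⊗ᴴ L))) =
      leg12 F * leg23 (Z * comm L L) * leg12 F * leg23 (Z * comm L L)⁻¹ * leg23 F) :
    (prep F * leg12 F : UnitaryOp (L ⊗ᴴ (L ⊗ᴴ L))) =
      leg12 F * (prep Z * leg13 F * (prep Z)⁻¹) * prep F := by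
  -- `leg13` is conjugation of `leg12` by `Σ₂₃`, which is exactly the flip contained in `c₂₃`.
  have h13 : (leg13 F : UnitaryOp (L ⊗ᴴ (L ⊗ᴴ L))) =
      prep (comm L L) * leg12 F * (prep (comm L L))⁻¹ := rfl
  simp only [leg23_eq_prep, prep_mul, prep_inv] at h
  rw [h, h13]
  simp only [mul_inv_rev, mul_assoc]

theorem semidirectFibre_pentagon (hF : IsBraidedMultiplicativeUnitary W U V F) :
    (leg23 (semidirectFibre V F) * leg12 (semidirectFibre V F) :
      UnitaryOp ((H ⊗ᴴ L) ⊗ᴴ ((H ⊗ᴴ L) ⊗ᴴ (H ⊗ᴴ L)))) =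
    leg12 (semidirectFibre V F) * ((leg23 (semidirectProjection W U))⁻¹ *
      leg13 (semidirectFibre V F) * leg23 (semidirectProjection W U)) *
      leg23 (semidirectFibre V F) := by
  obtain ⟨Z, hZ, hp⟩ := hF.braided_pentagon
  replace hp := braided_pentagon_flip hp
  apply flatten_injective
  simp only [flatten_mul, flatten_inv, flatten_leg12_fibre, flatten_leg13_fibre,
    flatten_leg23_fibre, flatten_leg23_projection]
  -- The digits name the legs of `H ⊗ L ⊗ H ⊗ L ⊗ H ⊗ L` to which each hypothesis is transported.
  have h345 := congrArg (fun T => (prep (prep (app4 T)) :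
    UnitaryOp (H ⊗ᴴ (L ⊗ᴴ (H ⊗ᴴ (L ⊗ᴴ (H ⊗ᴴ L))))))) hF.compatible
  have h356 := congrArg (fun T => (prep (prep (leg13 T)) :
    UnitaryOp (H ⊗ᴴ (L ⊗ᴴ (H ⊗ᴴ (L ⊗ᴴ (H ⊗ᴴ L))))))) hF.leftRep
  have h456 := congrArg (fun T => (prep (prep (prep T)) :
    UnitaryOp (H ⊗ᴴ (L ⊗ᴴ (H ⊗ᴴ (L ⊗ᴴ (H ⊗ᴴ L))))))) hZ
  have h346 := congrArg (fun T => (prep (prep (ins3 T)) :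
    UnitaryOp (H ⊗ᴴ (L ⊗ᴴ (H ⊗ᴴ (L ⊗ᴴ (H ⊗ᴴ L))))))) hF.left_invariant
  have h246 := congrArg (fun T => (prep (leg13 (ins3 T)) :
    UnitaryOp (H ⊗ᴴ (L ⊗ᴴ (H ⊗ᴴ (L ⊗ᴴ (H ⊗ᴴ L))))))) hp
  simp only [leg23_eq_prep, app4_mul, app4_leg12, app4_leg13, app4_prep, ins3_mul, ins3_inv,
    ins3_leg12, ins3_leg13, ins3_prep, leg13_mul, leg13_inv, leg13_prep, prep_mul, prep_inv]
    at h345 h356 h456 h346 h246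
  refine word_braided_pentagon h345 h356 h456 h346 h246 ?_ ?_ ?_ ?_ ?_ ?_ ?_ ?_
  · exact commute_prep (commute_prep (commute_leg12_prep V V))
  · exact commute_prep (commute_prep (commute_leg13_leg13_prep_leg12 V U))
  · exact commute_prep (commute_prep (commute_leg13_leg12_prep_leg13 W Z))
  · simpa only [ins3_leg13, ins3_prep] using
      (commute_prep (A := H) (commute_ins3 (D := L) (commute_leg13_leg13_prep_leg12 F W))).symm
  · exact (commute_prep (commute_leg13_leg13_prep_leg12 (leg13 F) V)).symm
  · simpa only [leg13_prep] using (commute_prep (A := H)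
      (commute_leg13 (B := H) (commute_leg13_leg13_prep_leg12 F U))).symm
  · exact commute_prep (commute_leg13_leg12_prep_leg13 F (leg13 V))
  · simpa only [leg13_prep] using
      commute_prep (A := H) (commute_leg13 (B := H) (commute_leg12_prep F V))

theorem semidirectUnitary_multiplicative (hF : IsBraidedMultiplicativeUnitary W U V F) :
    IsMultiplicativeUnitary (semidirectUnitary W U V F) := by
  have hl := projection_leftRep hF
  simp only [IsLeftRep, semidirectUnitary_eq, leg12_mul] at hl
  simp only [IsMultiplicativeUnitary, semidirectUnitary_eq, leg12_mul, leg13_mul]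
  have h23 (S T : UnitaryOp ((H ⊗ᴴ L) ⊗ᴴ (H ⊗ᴴ L))) :
      (leg23 (S * T) : UnitaryOp ((H ⊗ᴴ L) ⊗ᴴ ((H ⊗ᴴ L) ⊗ᴴ (H ⊗ᴴ L)))) = leg23 S * leg23 T :=
    prep_mul S T
  rw [h23]
  exact word_pentagon hl (semidirectFibre_pentagon hF) commute_fibre_projection

end semidirect

end

theorem mainTheorem8 {H L : Type*}
    [NormedAddCommGroup H] [InnerProductSpace ℂ H] [CompleteSpace H]
    [NormedAddCommGroup L] [InnerProductSpace ℂ L] [CompleteSpace L]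
    (W : UnitaryOp (H ⊗ᴴ H)) (U : UnitaryOp (L ⊗ᴴ H))
    (V : UnitaryOp (H ⊗ᴴ L)) (F : UnitaryOp (L ⊗ᴴ L))
    (hF : IsBraidedMultiplicativeUnitary W U V F)
    (WC P : UnitaryOp ((H ⊗ᴴ L) ⊗ᴴ (H ⊗ᴴ L)))
    (hWC : WC = semidirectUnitary W U V F)
    (hP : P = semidirectProjection W U) :
    IsMultiplicativeUnitary WC ∧
    IsBicharacter WC W (bicharToBase W U) ∧
    IsBicharacter W WC (bicharFromBase W) ∧
    IsCompositeBicharacter (bicharToBase W U) (bicharFromBase W) P ∧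
    (leg23 P * leg12 WC : UnitaryOp ((H ⊗ᴴ L) ⊗ᴴ ((H ⊗ᴴ L) ⊗ᴴ (H ⊗ᴴ L)))) =
      leg12 WC * leg13 P * leg23 P ∧
    (leg23 WC * leg12 P : UnitaryOp ((H ⊗ᴴ L) ⊗ᴴ ((H ⊗ᴴ L) ⊗ᴴ (H ⊗ᴴ L)))) =
      leg12 P * leg13 P * leg23 WC ∧
    (leg23 P * leg12 P : UnitaryOp ((H ⊗ᴴ L) ⊗ᴴ ((H ⊗ᴴ L) ⊗ᴴ (H ⊗ᴴ L)))) =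
      leg12 P * leg13 P * leg23 P := by
  subst hWC hP
  exact ⟨semidirectUnitary_multiplicative hF,
    ⟨bicharToBase_rightRep hF.multiplicative hF.rightRep, bicharToBase_leftRep hF⟩,
    ⟨bicharFromBase_rightRep hF.multiplicative, bicharFromBase_leftRep hF.multiplicative⟩,
    bicharFromBase_composite hF.multiplicative hF.rightRep, projection_leftRep hF,
    projection_rightRep hF.multiplicative hF.rightRep,
    projection_idempotent hF.multiplicative hF.rightRep⟩
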